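/- Let $G_H=\mathbb{R}^3$ be the (continuous) Heisenberg group, with product $(u,v,w)(a,b,c)=(u+a,\,v+b,\,w+c+ub)$, the Euclidean topology, and Lebesgue measure as Haar measure. A weight on $G_H$ is a continuous function $\omega:G_H\to(0,\infty)$ with $\omega(xy)\le\omega(x)\omega(y)$ for all $x,y\in G_H$, and the Beurling algebra $L^1(G_H,\omega)=\{f:\ f\omega\in L^1(G_H)\}$ is the complex Banach algebra with norm $\|f\|_\omega=\int |f(x)|\,\omega(x)\,dx$ and convolution product $(f*g)(x)=\int f(y)g(y^{-1}x)\,dy$. A Banach algebra $A$ is weakly amenable if every continuous derivation $D:A\to A^*$ is inner, that is, of the form $D(a)=a\cdot\varphi-\varphi\cdot a$ for some $\varphi\in A^*$, where $\langle x,a\cdot\varphi\rangle=\langle xa,\varphi\rangle$ and $\langle x,\varphi\cdot a\rangle=\langle ax,\varphi\rangle$. Let $\omega$ be a weight on $G_H$ of the form $\omega(u,v,w)=W(|u|,|v|)$ for a function $W$ on $[0,\infty)^2$ such that \[ \lim_{(x,y)\to\infty}W(x,y)=\infty . \] Then $L^1(G_H,\omega)$ is not weakly amenable. In particular, for every $\alpha>0$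 the function $\omega_\alpha(u,v,w)=(1+|u|+|v|)^\alpha$ is a weight on $G_H$, and $L^1(G_H,\omega_\alpha)$ is not weakly amenable. -/

import Mathlib

open MeasureTheory Filter Topology
open scoped ENNReal NNReal

/-! ## Weak amenability of a Banach algebra -/

section WeakAmenability

variable {A : Type*} [NonUnitalNormedRing A] [NormedSpace ℂ A] [IsScalarTower ℂ A A]
  [SMulCommClass ℂ A A]

/-- The left module action of `A` on its dual: `⟨x, a · φ⟩ = ⟨x * a, φ⟩`. -/
noncomputable def dualLeftAction (a : A) (φ : StrongDual ℂ A) : StrongDual ℂ A :=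
  φ.comp ((ContinuousLinearMap.mul ℂ A).flip a)

/-- The right module action of `A` on its dual: `⟨x, φ · a⟩ = ⟨a * x, φ⟩`. -/
noncomputable def dualRightAction (φ : StrongDual ℂ A) (a : A) : StrongDual ℂ A :=
  φ.comp (ContinuousLinearMap.mul ℂ A a)

theorem dualLeftAction_apply (a : A) (φ : StrongDual ℂ A) (x : A) :
    dualLeftAction a φ x = φ (x * a) := rfl

theorem dualRightAction_apply (φ : StrongDual ℂ A) (a x : A) :
    dualRightAction φ a x = φ (a * x) := rfl

/-- `D : A → A*` is a derivation: `D (a * b) = a · D b + D a · b`. -/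
def IsDualDerivation (D : A →L[ℂ] StrongDual ℂ A) : Prop :=
  ∀ a b : A, D (a * b) = dualLeftAction a (D b) + dualRightAction (D a) b

/-- `D : A → A*` is inner: `D a = a · φ - φ · a` for some `φ ∈ A*`. -/
def IsInnerDualDerivation (D : A →L[ℂ] StrongDual ℂ A) : Prop :=
  ∃ φ : StrongDual ℂ A, ∀ a : A, D a = dualLeftAction a φ - dualRightAction φ a

variable (A) in
/-- A Banach algebra `A` is weakly amenable if every continuous derivation from `A` into its
dual `A*` is inner. -/
def IsWeaklyAmenable [CompleteSpace A] : Prop :=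
  ∀ D : A →L[ℂ] StrongDual ℂ A, IsDualDerivation D → IsInnerDualDerivation D

end WeakAmenability

/-! ## Weights and Beurling algebras -/

/-- A (continuous) weight on a topological group: a continuous positive submultiplicative
function. -/
structure GroupWeight (G : Type*) [Group G] [TopologicalSpace G] where
  toFun : G → ℝ
  continuous_toFun : Continuous toFun
  pos : ∀ x, 0 < toFun x
  submul : ∀ x y, toFun (x * y) ≤ toFun x * toFun y

instance {G : Type*} [Group G] [TopologicalSpace G] :
    CoeFun (GroupWeight G) (fun _ => G → ℝ) := ⟨GroupWeight.toFun⟩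

/-- The convolution product `(f * g)(x) = ∫ f(y) g(y⁻¹ x) dy`. -/
noncomputable def groupConvolution {G : Type*} [Group G] [MeasurableSpace G] (μ : Measure G)
    (f g : G → ℂ) (x : G) : ℂ :=
  ∫ y, f y * g (y⁻¹ * x) ∂μ

/-- The measure `ω(x) dx`. -/
noncomputable def GroupWeight.weightedMeasure {G : Type*} [Group G] [TopologicalSpace G]
    [MeasurableSpace G] (ω : GroupWeight G) (μ : Measure G) : Measure G :=
  μ.withDensity (fun x => ENNReal.ofReal (ω x))

/-- The space `L¹(G, ω)`, realised as the space of (classes of) functions which are integrable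
with respect to `ω(x) dx`; its norm is `∫ |f(x)| ω(x) dx`
(see `BeurlingAlgebra.mem_iff`, `BeurlingAlgebra.norm_eq`). -/
def BeurlingAlgebra {G : Type*} [Group G] [TopologicalSpace G] [MeasurableSpace G]
    (ω : GroupWeight G) (μ : Measure G) : Type _ :=
  Lp ℂ 1 (ω.weightedMeasure μ)

namespace BeurlingAlgebra

section Basic

variable {G : Type*} [Group G] [TopologicalSpace G] [MeasurableSpace G]
  (ω : GroupWeight G) (μ : Measure G)

noncomputable instance : NormedAddCommGroup (BeurlingAlgebra ω μ) :=
  inferInstanceAs (NormedAddCommGroup (Lp ℂ 1 (ω.weightedMeasure μ)))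

noncomputable instance : NormedSpace ℂ (BeurlingAlgebra ω μ) :=
  inferInstanceAs (NormedSpace ℂ (Lp ℂ 1 (ω.weightedMeasure μ)))

instance : CompleteSpace (BeurlingAlgebra ω μ) :=
  inferInstanceAs (CompleteSpace (Lp ℂ 1 (ω.weightedMeasure μ)))

variable {ω μ}

/-- A representative of an element of `L¹(G, ω)`. -/
noncomputable def rep (f : BeurlingAlgebra ω μ) : G → ℂ :=
  ((show Lp ℂ 1 (ω.weightedMeasure μ) from f) : G → ℂ)

/-- The element of `L¹(G, ω)` defined by a function integrable with respect to `ω(x) dx`. -/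
noncomputable def mk (f : G → ℂ) (hf : Integrable f (ω.weightedMeasure μ)) :
    BeurlingAlgebra ω μ :=
  MemLp.toLp f (memLp_one_iff_integrable.2 hf)

theorem integrable_rep (f : BeurlingAlgebra ω μ) : Integrable f.rep (ω.weightedMeasure μ) :=
  L1.integrable_coeFn (show Lp ℂ 1 (ω.weightedMeasure μ) from f)

theorem weightedMeasure_ac : ω.weightedMeasure μ ≪ μ := withDensity_absolutelyContinuous _ _

theorem measurable_ofReal_weight [OpensMeasurableSpace G] :
    Measurable (fun x => ENNReal.ofReal (ω x)) :=
  ω.continuous_toFun.measurable.ennreal_ofReal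

theorem ac_weightedMeasure [OpensMeasurableSpace G] : μ ≪ ω.weightedMeasure μ :=
  withDensity_absolutelyContinuous' measurable_ofReal_weight.aemeasurable
    (ae_of_all _ fun x => (ENNReal.ofReal_pos.2 (ω.pos x)).ne')

theorem aestronglyMeasurable_rep [OpensMeasurableSpace G] (f : BeurlingAlgebra ω μ) :
    AEStronglyMeasurable f.rep μ :=
  f.integrable_rep.aestronglyMeasurable.mono_ac ac_weightedMeasure

theorem rep_mk [OpensMeasurableSpace G] (f : G → ℂ)
    (hf : Integrable f (ω.weightedMeasure μ)) : (mk f hf).rep =ᵐ[μ] f :=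
  ac_weightedMeasure.ae_eq (MemLp.coeFn_toLp (memLp_one_iff_integrable.2 hf))

theorem ext_rep [OpensMeasurableSpace G] {f g : BeurlingAlgebra ω μ}
    (h : f.rep =ᵐ[μ] g.rep) : f = g :=
  Lp.ext (weightedMeasure_ac.ae_eq h)

theorem rep_add [OpensMeasurableSpace G] (f g : BeurlingAlgebra ω μ) :
    (f + g).rep =ᵐ[μ] fun x => f.rep x + g.rep x :=
  ac_weightedMeasure.ae_eq (Lp.coeFn_add (show Lp ℂ 1 (ω.weightedMeasure μ) from f) g)

theorem rep_smul [OpensMeasurableSpace G] (c : ℂ) (f : BeurlingAlgebra ω μ) :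
    (c • f).rep =ᵐ[μ] fun x => c * f.rep x :=
  ac_weightedMeasure.ae_eq (Lp.coeFn_smul c (show Lp ℂ 1 (ω.weightedMeasure μ) from f))

/-- Membership in `L¹(G, ω)` means that `f ω` is integrable for the Haar measure. -/
theorem mem_iff [OpensMeasurableSpace G] (f : G → ℂ) :
    Integrable f (ω.weightedMeasure μ) ↔ Integrable (fun x => f x * (ω x : ℂ)) μ := by
  unfold GroupWeight.weightedMeasure
  rw [integrable_withDensity_iff_integrable_smul' measurable_ofReal_weight
    (ae_of_all _ fun _ => ENNReal.ofReal_lt_top)]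
  refine integrable_congr (ae_of_all _ fun x => ?_)
  simp [ENNReal.toReal_ofReal (ω.pos x).le, mul_comm]

/-- The norm of `L¹(G, ω)` is `∫ |f(x)| ω(x) dx`. -/
theorem norm_eq [OpensMeasurableSpace G] (f : BeurlingAlgebra ω μ) :
    ‖f‖ = ∫ x, ‖f.rep x‖ * ω x ∂μ := by
  have h : ‖f‖ = ∫ x, ‖f.rep x‖ ∂(ω.weightedMeasure μ) :=
    L1.norm_eq_integral_norm (show Lp ℂ 1 (ω.weightedMeasure μ) from f)
  rw [h]
  unfold GroupWeight.weightedMeasure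
  rw [integral_withDensity_eq_integral_toReal_smul measurable_ofReal_weight
    (ae_of_all _ fun _ => ENNReal.ofReal_lt_top)]
  refine integral_congr_ae (ae_of_all _ fun x => ?_)
  simp [ENNReal.toReal_ofReal (ω.pos x).le, mul_comm]

theorem enorm_eq (f : BeurlingAlgebra ω μ) :
    ‖f‖ₑ = ∫⁻ x, ‖f.rep x‖ₑ ∂(ω.weightedMeasure μ) := by
  have := Lp.enorm_def (show Lp ℂ 1 (ω.weightedMeasure μ) from f)
  rw [eLpNorm_one_eq_lintegral_enorm] at this
  exact this

end Basic

section Product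

variable {G : Type*} [Group G] [TopologicalSpace G] [IsTopologicalGroup G]
  [LocallyCompactSpace G] [SecondCountableTopology G] [MeasurableSpace G] [BorelSpace G]
  {ω : GroupWeight G} {μ : Measure G} [μ.IsHaarMeasure]

theorem lintegral_translate_le {F : G → ℝ≥0∞} (hF : AEMeasurable F μ) (y : G) :
    ∫⁻ x, F (y⁻¹ * x) ∂(ω.weightedMeasure μ)
      ≤ ENNReal.ofReal (ω y) * ∫⁻ x, F x ∂(ω.weightedMeasure μ) := by
  have hF' : AEMeasurable (fun x => F (y⁻¹ * x)) μ :=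
    hF.comp_quasiMeasurePreserving (measurePreserving_mul_left μ y⁻¹).quasiMeasurePreserving
  unfold GroupWeight.weightedMeasure
  rw [lintegral_withDensity_eq_lintegral_mul₀ measurable_ofReal_weight.aemeasurable hF',
    lintegral_withDensity_eq_lintegral_mul₀
      measurable_ofReal_weight.aemeasurable hF,
    ← lintegral_const_mul' _ _ ENNReal.ofReal_ne_top,
    ← lintegral_mul_left_eq_self _ y]
  refine lintegral_mono fun x => ?_
  simp only [Pi.mul_apply, ← mul_assoc, inv_mul_cancel, one_mul]
  rw [← ENNReal.ofReal_mul (ω.pos y).le]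
  gcongr
  exact ω.submul y x

theorem lintegral_mlconvolution_le {F H : G → ℝ≥0∞} (hF : AEMeasurable F μ)
    (hH : AEMeasurable H μ) :
    ∫⁻ x, mlconvolution F H μ x ∂(ω.weightedMeasure μ)
      ≤ (∫⁻ x, F x ∂(ω.weightedMeasure μ)) * ∫⁻ x, H x ∂(ω.weightedMeasure μ) := by
  have : SFinite (ω.weightedMeasure μ) := by
    unfold GroupWeight.weightedMeasure; infer_instance
  unfold mlconvolution
  have hm : AEMeasurable (fun p : G × G => F p.2 * H (p.2⁻¹ * p.1))
      ((ω.weightedMeasure μ).prod μ) := by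
    refine AEMeasurable.mono_ac (ν := μ.prod μ) (by fun_prop) ?_
    exact weightedMeasure_ac.prod Measure.AbsolutelyContinuous.rfl
  rw [lintegral_lintegral_swap hm]
  calc ∫⁻ y, ∫⁻ x, F y * H (y⁻¹ * x) ∂(ω.weightedMeasure μ) ∂μ
      ≤ ∫⁻ y, (ENNReal.ofReal (ω y) * F y) * ∫⁻ x, H x ∂(ω.weightedMeasure μ) ∂μ := by
        refine lintegral_mono fun y => ?_
        have hHy : AEMeasurable (fun x => H (y⁻¹ * x)) (ω.weightedMeasure μ) :=
          (hH.comp_quasiMeasurePreserving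
            (measurePreserving_mul_left μ y⁻¹).quasiMeasurePreserving).mono_ac weightedMeasure_ac
        rw [lintegral_const_mul'' _ hHy]
        rw [mul_comm (ENNReal.ofReal _), mul_assoc]
        gcongr
        exact lintegral_translate_le hH y
    _ = _ := by
        have hωF : AEMeasurable (fun y => ENNReal.ofReal (ω y) * F y) μ :=
          measurable_ofReal_weight.aemeasurable.mul hF
        rw [lintegral_mul_const'' _ hωF]
        congr 1
        unfold GroupWeight.weightedMeasure
        rw [lintegral_withDensity_eq_lintegral_mul₀ measurable_ofReal_weight.aemeasurable hF]
        rfl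

theorem aestronglyMeasurable_groupConvolution {f g : G → ℂ} (hf : AEStronglyMeasurable f μ)
    (hg : AEStronglyMeasurable g μ) : AEStronglyMeasurable (groupConvolution μ f g) μ := by
  have h1 : AEStronglyMeasurable (fun p : G × G => f p.2 * g (p.2⁻¹ * p.1)) (μ.prod μ) :=
    (hf.comp_snd).mul
      (hg.comp_quasiMeasurePreserving (quasiMeasurePreserving_inv_mul_swap μ μ))
  exact h1.integral_prod_right'

theorem enorm_groupConvolution_le {G : Type*} [Group G] [MeasurableSpace G]
    {μ : Measure G} (f g : G → ℂ) (x : G) :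
    ‖groupConvolution μ f g x‖ₑ ≤ mlconvolution (fun y => ‖f y‖ₑ) (fun y => ‖g y‖ₑ) μ x := by
  refine (enorm_integral_le_lintegral_enorm _).trans_eq ?_
  simp [mlconvolution, enorm_mul]

/-- `L¹(G, ω)` is closed under convolution. -/
theorem integrable_groupConvolution (f g : BeurlingAlgebra ω μ) :
    Integrable (groupConvolution μ f.rep g.rep) (ω.weightedMeasure μ) := by
  refine ⟨(aestronglyMeasurable_groupConvolution f.aestronglyMeasurable_rep
    g.aestronglyMeasurable_rep).mono_ac weightedMeasure_ac, ?_⟩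
  refine (lintegral_mono fun x => enorm_groupConvolution_le f.rep g.rep x).trans_lt ?_
  refine (lintegral_mlconvolution_le f.aestronglyMeasurable_rep.enorm
    g.aestronglyMeasurable_rep.enorm).trans_lt ?_
  exact ENNReal.mul_lt_top f.integrable_rep.2 g.integrable_rep.2

/-- The convolution product of `L¹(G, ω)`. -/
noncomputable instance : Mul (BeurlingAlgebra ω μ) :=
  ⟨fun f g => mk (groupConvolution μ f.rep g.rep) (integrable_groupConvolution f g)⟩

theorem rep_mul (f g : BeurlingAlgebra ω μ) :
    (f * g).rep =ᵐ[μ] groupConvolution μ f.rep g.rep :=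
  rep_mk _ (integrable_groupConvolution f g)

theorem groupConvolution_congr {f f' g g' : G → ℂ} (hf : f =ᵐ[μ] f') (hg : g =ᵐ[μ] g') :
    groupConvolution μ f g = groupConvolution μ f' g' := by
  funext x
  refine integral_congr_ae ?_
  have hq : Measure.QuasiMeasurePreserving (fun y : G => y⁻¹ * x) μ μ :=
    (quasiMeasurePreserving_mul_right μ x).comp (quasiMeasurePreserving_inv μ)
  filter_upwards [hf, hq.ae_eq hg] with y h1 h2
  simp only [Function.comp] at h2
  rw [h1, h2]

theorem ae_mlconvolution_lt_top {F H : G → ℝ≥0∞} (hF : AEMeasurable F μ)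
    (hH : AEMeasurable H μ) (hF' : ∫⁻ x, F x ∂(ω.weightedMeasure μ) < ∞)
    (hH' : ∫⁻ x, H x ∂(ω.weightedMeasure μ) < ∞) :
    ∀ᵐ x ∂μ, mlconvolution F H μ x < ∞ := by
  refine (ac_weightedMeasure (ω := ω)).ae_le (ae_lt_top' ?_ ?_)
  · exact (aemeasurable_mlconvolution hF hH).mono_ac weightedMeasure_ac
  · exact ((lintegral_mlconvolution_le hF hH).trans_lt (ENNReal.mul_lt_top hF' hH')).ne

theorem aestronglyMeasurable_kernel {f g : G → ℂ} (hf : AEStronglyMeasurable f μ)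
    (hg : AEStronglyMeasurable g μ) (x : G) :
    AEStronglyMeasurable (fun y => f y * g (y⁻¹ * x)) μ :=
  hf.mul (hg.comp_quasiMeasurePreserving
    ((quasiMeasurePreserving_mul_right μ x).comp (quasiMeasurePreserving_inv μ)))

theorem ae_integrable_kernel (f g : BeurlingAlgebra ω μ) :
    ∀ᵐ x ∂μ, Integrable (fun y => f.rep y * g.rep (y⁻¹ * x)) μ := by
  filter_upwards [ae_mlconvolution_lt_top f.aestronglyMeasurable_rep.enorm
    g.aestronglyMeasurable_rep.enorm f.integrable_rep.2 g.integrable_rep.2] with x hx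
  refine ⟨aestronglyMeasurable_kernel f.aestronglyMeasurable_rep g.aestronglyMeasurable_rep x,
    ?_⟩
  simpa [HasFiniteIntegral, mlconvolution, enorm_mul] using hx

protected theorem mul_add' (f g h : BeurlingAlgebra ω μ) : f * (g + h) = f * g + f * h := by
  refine ext_rep ?_
  refine ((rep_mul _ _).trans ?_).trans (rep_add _ _).symm
  rw [groupConvolution_congr (ae_eq_refl f.rep) (rep_add g h)]
  filter_upwards [rep_mul f g, rep_mul f h, ae_integrable_kernel f g, ae_integrable_kernel f h]
    with x h1 h2 h3 h4
  rw [h1, h2, groupConvolution, groupConvolution, groupConvolution, ← integral_add h3 h4]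
  simp only [mul_add]

protected theorem add_mul' (f g h : BeurlingAlgebra ω μ) : (f + g) * h = f * h + g * h := by
  refine ext_rep ?_
  refine ((rep_mul _ _).trans ?_).trans (rep_add _ _).symm
  rw [groupConvolution_congr (rep_add f g) (ae_eq_refl h.rep)]
  filter_upwards [rep_mul f h, rep_mul g h, ae_integrable_kernel f h, ae_integrable_kernel g h]
    with x h1 h2 h3 h4
  rw [h1, h2, groupConvolution, groupConvolution, groupConvolution, ← integral_add h3 h4]
  simp only [add_mul]

protected theorem smul_mul' (c : ℂ) (f g : BeurlingAlgebra ω μ) :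
    (c • f) * g = c • (f * g) := by
  refine ext_rep ?_
  refine ((rep_mul _ _).trans ?_).trans (rep_smul _ _).symm
  rw [groupConvolution_congr (rep_smul c f) (ae_eq_refl g.rep)]
  filter_upwards [rep_mul f g] with x h1
  rw [h1, groupConvolution, groupConvolution, ← integral_const_mul]
  simp only [mul_assoc]

protected theorem mul_smul' (c : ℂ) (f g : BeurlingAlgebra ω μ) :
    f * (c • g) = c • (f * g) := by
  refine ext_rep ?_
  refine ((rep_mul _ _).trans ?_).trans (rep_smul _ _).symm
  rw [groupConvolution_congr (ae_eq_refl f.rep) (rep_smul c g)]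
  filter_upwards [rep_mul f g] with x h1
  rw [h1, groupConvolution, groupConvolution, ← integral_const_mul]
  simp only [mul_left_comm]

protected theorem norm_mul_le' (f g : BeurlingAlgebra ω μ) : ‖f * g‖ ≤ ‖f‖ * ‖g‖ := by
  have h : ‖f * g‖ₑ ≤ ‖f‖ₑ * ‖g‖ₑ := by
    rw [enorm_eq, enorm_eq, enorm_eq]
    refine (lintegral_congr_ae (g := fun x => ‖groupConvolution μ f.rep g.rep x‖ₑ)
      (weightedMeasure_ac.ae_eq ((rep_mul f g).fun_comp (fun z => ‖z‖ₑ)))).trans_le ?_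
    exact (lintegral_mono fun x => enorm_groupConvolution_le f.rep g.rep x).trans
      (lintegral_mlconvolution_le f.aestronglyMeasurable_rep.enorm
        g.aestronglyMeasurable_rep.enorm)
  have := ENNReal.toReal_mono (by finiteness) h
  simpa [ENNReal.toReal_mul, toReal_enorm] using this

protected theorem mul_assoc' (f g h : BeurlingAlgebra ω μ) : f * g * h = f * (g * h) := by
  refine ext_rep ?_
  refine (rep_mul _ _).trans (EventuallyEq.trans ?_ (rep_mul _ _).symm)
  rw [groupConvolution_congr (rep_mul f g) (ae_eq_refl h.rep),
    groupConvolution_congr (ae_eq_refl f.rep) (rep_mul g h)]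
  have hf := f.aestronglyMeasurable_rep
  have hg := g.aestronglyMeasurable_rep
  have hh := h.aestronglyMeasurable_rep
  have hfin := ae_mlconvolution_lt_top (ω := ω) (aemeasurable_mlconvolution hf.enorm hg.enorm)
    hh.enorm ((lintegral_mlconvolution_le hf.enorm hg.enorm).trans_lt
      (ENNReal.mul_lt_top f.integrable_rep.2 g.integrable_rep.2)) h.integrable_rep.2
  filter_upwards [hfin] with x hx
  have hm : AEStronglyMeasurable
      (fun p : G × G => f.rep p.2 * g.rep (p.2⁻¹ * p.1) * h.rep (p.1⁻¹ * x)) (μ.prod μ) := by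
    refine (hf.comp_snd.mul
      (hg.comp_quasiMeasurePreserving (quasiMeasurePreserving_inv_mul_swap μ μ))).mul ?_
    exact (hh.comp_quasiMeasurePreserving ((quasiMeasurePreserving_mul_right μ x).comp
      (quasiMeasurePreserving_inv μ))).comp_fst
  have hint : Integrable
      (fun p : G × G => f.rep p.2 * g.rep (p.2⁻¹ * p.1) * h.rep (p.1⁻¹ * x)) (μ.prod μ) := by
    refine ⟨hm, ?_⟩
    rw [HasFiniteIntegral, lintegral_prod _ hm.enorm]
    refine lt_of_le_of_lt (lintegral_mono fun y => ?_) hx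
    simp only [enorm_mul]
    rw [lintegral_mul_const' _ _ enorm_ne_top]
    rfl
  calc groupConvolution μ (groupConvolution μ f.rep g.rep) h.rep x
      = ∫ y, ∫ z, f.rep z * g.rep (z⁻¹ * y) * h.rep (y⁻¹ * x) ∂μ ∂μ := by
        simp only [groupConvolution, integral_mul_const]
    _ = ∫ z, ∫ y, f.rep z * g.rep (z⁻¹ * y) * h.rep (y⁻¹ * x) ∂μ ∂μ :=
        integral_integral_swap hint
    _ = groupConvolution μ f.rep (groupConvolution μ g.rep h.rep) x := by
        simp only [groupConvolution]
        congr 1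
        funext z
        rw [← integral_const_mul, ← integral_mul_left_eq_self _ z]
        congr 1
        funext y
        simp [mul_assoc]

/-- `L¹(G, ω)` with convolution is a Banach algebra. -/
noncomputable instance : NonUnitalNormedRing (BeurlingAlgebra ω μ) where
  __ := (inferInstance : NormedAddCommGroup (BeurlingAlgebra ω μ))
  mul := (· * ·)
  left_distrib := BeurlingAlgebra.mul_add'
  right_distrib := BeurlingAlgebra.add_mul'
  zero_mul f := by simpa using BeurlingAlgebra.smul_mul' 0 0 f
  mul_zero f := by simpa using BeurlingAlgebra.mul_smul' 0 f 0
  mul_assoc := BeurlingAlgebra.mul_assoc'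
  norm_mul_le := BeurlingAlgebra.norm_mul_le'

instance : IsScalarTower ℂ (BeurlingAlgebra ω μ) (BeurlingAlgebra ω μ) :=
  ⟨BeurlingAlgebra.smul_mul'⟩

instance : SMulCommClass ℂ (BeurlingAlgebra ω μ) (BeurlingAlgebra ω μ) :=
  ⟨fun c f g => (BeurlingAlgebra.mul_smul' c f g).symm⟩

end Product

end BeurlingAlgebra

/-! ## The Heisenberg group -/

/-- The Heisenberg group `G_H`; `⟨u, v, w⟩` stands for the matrix
`!![1, u, w; 0, 1, v; 0, 0, 1]`. -/
@[ext]
structure HeisenbergGroup where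
  u : ℝ
  v : ℝ
  w : ℝ

namespace HeisenbergGroup

/-- The matrix of an element of the Heisenberg group. -/
def toMatrix (x : HeisenbergGroup) : Matrix (Fin 3) (Fin 3) ℝ :=
  !![1, x.u, x.w; 0, 1, x.v; 0, 0, 1]

instance : Mul HeisenbergGroup := ⟨fun x y => ⟨x.u + y.u, x.v + y.v, x.w + y.w + x.u * y.v⟩⟩

instance : One HeisenbergGroup := ⟨⟨0, 0, 0⟩⟩

instance : Inv HeisenbergGroup := ⟨fun x => ⟨-x.u, -x.v, x.u * x.v - x.w⟩⟩

@[simp] theorem mul_u (x y : HeisenbergGroup) : (x * y).u = x.u + y.u := rfl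
@[simp] theorem mul_v (x y : HeisenbergGroup) : (x * y).v = x.v + y.v := rfl
@[simp] theorem mul_w (x y : HeisenbergGroup) : (x * y).w = x.w + y.w + x.u * y.v := rfl
@[simp] theorem one_u : (1 : HeisenbergGroup).u = 0 := rfl
@[simp] theorem one_v : (1 : HeisenbergGroup).v = 0 := rfl
@[simp] theorem one_w : (1 : HeisenbergGroup).w = 0 := rfl
@[simp] theorem inv_u (x : HeisenbergGroup) : x⁻¹.u = -x.u := rfl
@[simp] theorem inv_v (x : HeisenbergGroup) : x⁻¹.v = -x.v := rfl
@[simp] theorem inv_w (x : HeisenbergGroup) : x⁻¹.w = x.u * x.v - x.w := rfl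

theorem toMatrix_mul (x y : HeisenbergGroup) :
    (x * y).toMatrix = x.toMatrix * y.toMatrix := by
  ext i j
  fin_cases i <;> fin_cases j <;> simp [toMatrix, Matrix.mul_apply, Fin.sum_univ_three] <;> ring

instance : Group HeisenbergGroup :=
  Group.ofLeftAxioms
    (fun x y z => by ext <;> simp <;> ring)
    (fun x => by ext <;> simp)
    (fun x => by ext <;> simp)

/-- The coordinates `(u, v, w)`. -/
def coords : HeisenbergGroup ≃ ℝ × ℝ × ℝ where
  toFun x := (x.u, x.v, x.w)
  invFun p := ⟨p.1, p.2.1, p.2.2⟩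
  left_inv _ := rfl
  right_inv _ := rfl

/-- The Euclidean topology. -/
instance : TopologicalSpace HeisenbergGroup := TopologicalSpace.induced coords inferInstance

/-- The Borel σ-algebra. -/
instance : MeasurableSpace HeisenbergGroup := borel HeisenbergGroup

instance : BorelSpace HeisenbergGroup := ⟨rfl⟩

/-- The coordinates as a homeomorphism with `ℝ³`. -/
def coordsHomeomorph : HeisenbergGroup ≃ₜ ℝ × ℝ × ℝ :=
  coords.toHomeomorphOfIsInducing ⟨rfl⟩

theorem continuous_u : Continuous HeisenbergGroup.u :=
  continuous_fst.comp coordsHomeomorph.continuous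
theorem continuous_v : Continuous HeisenbergGroup.v :=
  (continuous_fst.comp continuous_snd).comp coordsHomeomorph.continuous
theorem continuous_w : Continuous HeisenbergGroup.w :=
  (continuous_snd.comp continuous_snd).comp coordsHomeomorph.continuous

instance : IsTopologicalGroup HeisenbergGroup where
  continuous_mul := by
    have := continuous_u; have := continuous_v; have := continuous_w
    refine coordsHomeomorph.isInducing.continuous_iff.2 ?_
    change Continuous fun p : HeisenbergGroup × HeisenbergGroup =>
      (p.1.u + p.2.u, p.1.v + p.2.v, p.1.w + p.2.w + p.1.u * p.2.v)
    fun_prop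
  continuous_inv := by
    have := continuous_u; have := continuous_v; have := continuous_w
    refine coordsHomeomorph.isInducing.continuous_iff.2 ?_
    change Continuous fun p : HeisenbergGroup => (-p.u, -p.v, p.u * p.v - p.w)
    fun_prop

instance : LocallyCompactSpace HeisenbergGroup :=
  coordsHomeomorph.isClosedEmbedding.locallyCompactSpace

instance : SecondCountableTopology HeisenbergGroup :=
  coordsHomeomorph.secondCountableTopology

/-- The Lebesgue measure `du dv dw`. -/
noncomputable instance : MeasureSpace HeisenbergGroup where
  volume := Measure.map coordsHomeomorph.symm volume

theorem volume_eq : (volume : Measure HeisenbergGroup) =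
    Measure.map coordsHomeomorph.symm volume := rfl

instance : (volume : Measure HeisenbergGroup).IsMulLeftInvariant := by
  refine ⟨fun g => ?_⟩
  have hL : MeasurePreserving
      (fun p : ℝ × ℝ × ℝ => (g.u + p.1, g.v + p.2.1, g.w + p.2.2 + g.u * p.2.1))
      volume volume := by
    have h2 : MeasurePreserving
        (fun q : ℝ × ℝ => (g.v + q.1, g.w + q.2 + g.u * q.1)) volume volume := by
      refine (measurePreserving_add_left (volume : Measure ℝ) g.v).skew_product
        (g := fun b c => g.w + c + g.u * b) (by fun_prop) (ae_of_all _ fun b => ?_)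
      have h3 : (fun c => g.w + c + g.u * b) = fun c => (g.w + g.u * b) + c := by
        funext c; ring
      rw [h3]
      exact (measurePreserving_add_left (volume : Measure ℝ) _).map_eq
    exact (measurePreserving_add_left (volume : Measure ℝ) g.u).prod h2
  rw [volume_eq, Measure.map_map (by fun_prop) (by fun_prop)]
  conv_rhs => rw [← hL.map_eq]
  rw [Measure.map_map (by fun_prop) hL.measurable]
  rfl

/-- The Lebesgue measure is a Haar measure of the Heisenberg group. -/
instance : (volume : Measure HeisenbergGroup).IsHaarMeasure where
  lt_top_of_isCompact K hK := by
    have h : (volume : Measure HeisenbergGroup) K =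
        volume (coordsHomeomorph.symm ⁻¹' K) :=
      coordsHomeomorph.symm.toMeasurableEquiv.map_apply K
    rw [h]
    exact (coordsHomeomorph.symm.isCompact_preimage.2 hK).measure_lt_top
  toIsOpenPosMeasure :=
    coordsHomeomorph.symm.continuous.isOpenPosMeasure_map coordsHomeomorph.symm.surjective

end HeisenbergGroup

/-! ## A uniform estimate in weakly amenable Banach algebras -/

/-! In a weakly amenable algebra the inner derivations are exactly the derivations, hence form a
closed subspace of the bounded operators. By the open mapping theorem there is a constant `C` such
that every functional `φ` may be replaced by some `ψ` inducing the same inner derivation, with norm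
at most `C` times the norm of that derivation. As `φ` and `ψ` agree on commutators, `|φ(ab - ba)|`
is at most `C * M * ‖ab - ba‖` as soon as `|φ(ab - ba)| ≤ M * ‖a‖ * ‖b‖` for all `a`, `b`
(`IsWeaklyAmenable.exists_norm_commutator_le`).

For the Heisenberg group this fails. The weight ignores the central coordinate `w`, so it stays
bounded on `|u|, |v| ≤ 1`, while conjugation by `(0, S, 0)` moves `w` by `-S * u` and fixes `u`,
`v`. Integration against `φ = min N (|w| / R)`, cut off to that square, detects this displacement.
The difference `φ(xy) - φ(yx)` is at most `min N ((|x.u| + |x.v|) / R)`. Because the weight tends to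
infinity, a large `R` makes this at most `ω x * ω y` whatever `N` is, so the inner derivation has
norm at most 1.

Testing on the indicators of `s * box` and `box * s⁻¹`, with `s = (0, S, 0)`, gives a commutator of
norm at most `2 * M * V`, where `M` bounds the weight on the square and `V` is the product of the
two volumes. On it `φ` is at least `(N - 3) * V`. Hence `N - 3 ≤ 2 * C * M`, which is false for
large `N`. -/

/-- A closed range is itself a Banach space, so the open mapping theorem applies to the
corestriction. The map need not be injective, hence the change of preimage. -/
theorem ContinuousLinearMap.exists_norm_le_of_isClosed_range {E F : Type*}
    [NormedAddCommGroup E] [NormedSpace ℂ E] [CompleteSpace E] [NormedAddCommGroup F]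
    [NormedSpace ℂ F] [CompleteSpace F] (T : E →L[ℂ] F) (hT : IsClosed (Set.range T)) :
    ∃ C : ℝ, 0 < C ∧ ∀ x, ∃ y, T y = T x ∧ ‖y‖ ≤ C * ‖T x‖ := by
  have : CompleteSpace (LinearMap.range T.toLinearMap) := IsClosed.completeSpace_coe (hs := hT)
  obtain ⟨C, hC, h⟩ := ContinuousLinearMap.exists_preimage_norm_le
    (T.codRestrict (LinearMap.range T.toLinearMap) fun x => ⟨x, rfl⟩)
    (by rintro ⟨_, x, rfl⟩; exact ⟨x, rfl⟩)
  refine ⟨C, hC, fun x => ?_⟩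
  obtain ⟨y, hy, hn⟩ := h ⟨T x, x, rfl⟩
  exact ⟨y, congrArg Subtype.val hy, hn⟩

section WeakAmenability

variable {A : Type*} [NonUnitalNormedRing A] [NormedSpace ℂ A] [IsScalarTower ℂ A A]
  [SMulCommClass ℂ A A]

theorem isDualDerivation_iff {D : A →L[ℂ] StrongDual ℂ A} :
    IsDualDerivation D ↔ ∀ a b x : A, D (a * b) x = D b (x * a) + D a (b * x) :=
  ⟨fun h a b x => by rw [h a b]; rfl, fun h a b => by ext x; exact h a b x⟩

/-- The Leibniz rule is a family of scalar equations, each continuous in `D`. -/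
theorem isClosed_setOf_isDualDerivation :
    IsClosed {D : A →L[ℂ] StrongDual ℂ A | IsDualDerivation D} := by
  simp only [isDualDerivation_iff, Set.ofPred_forall]
  refine isClosed_iInter fun a => isClosed_iInter fun b => isClosed_iInter fun x => ?_
  have hc (c y : A) : Continuous fun D : A →L[ℂ] StrongDual ℂ A => D c y := by fun_prop
  exact isClosed_eq (hc _ _) ((hc _ _).add (hc _ _))

variable (A) in
/-- The map sending `φ` to the inner derivation `a ↦ a · φ - φ · a`. -/
noncomputable def innerDualDerivation : StrongDual ℂ A →L[ℂ] A →L[ℂ] StrongDual ℂ A :=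
  ((ContinuousLinearMap.compL ℂ A (A →L[ℂ] A) (StrongDual ℂ A)).flip
    ((ContinuousLinearMap.mul ℂ A).flip - ContinuousLinearMap.mul ℂ A)).comp
      (ContinuousLinearMap.compL ℂ A A ℂ)

@[simp] theorem innerDualDerivation_apply (φ : StrongDual ℂ A) (a x : A) :
    innerDualDerivation A φ a x = φ (x * a) - φ (a * x) :=
  map_sub φ (x * a) (a * x)

theorem isDualDerivation_innerDualDerivation (φ : StrongDual ℂ A) :
    IsDualDerivation (innerDualDerivation A φ) := by
  rw [isDualDerivation_iff]
  intro a b x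
  simp [mul_assoc]

theorem IsWeaklyAmenable.range_innerDualDerivation [CompleteSpace A] (h : IsWeaklyAmenable A) :
    Set.range (innerDualDerivation A) = {D | IsDualDerivation D} := by
  ext D
  refine ⟨?_, fun hD => ?_⟩
  · rintro ⟨φ, rfl⟩
    exact isDualDerivation_innerDualDerivation φ
  · obtain ⟨φ, hφ⟩ := h D hD
    refine ⟨φ, ?_⟩
    ext a x
    rw [hφ a, innerDualDerivation_apply]
    rfl

theorem IsWeaklyAmenable.exists_norm_commutator_le [CompleteSpace A] (h : IsWeaklyAmenable A) :
    ∃ C : ℝ, 0 < C ∧ ∀ (φ : StrongDual ℂ A) (M : ℝ), 0 ≤ M →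
      (∀ a b : A, ‖φ (a * b) - φ (b * a)‖ ≤ M * ‖a‖ * ‖b‖) →
      ∀ a b : A, ‖φ (a * b) - φ (b * a)‖ ≤ C * M * ‖a * b - b * a‖ := by
  have hcl : IsClosed (Set.range (innerDualDerivation A)) := by
    rw [h.range_innerDualDerivation]
    exact isClosed_setOf_isDualDerivation
  obtain ⟨C, hC, hpre⟩ := ContinuousLinearMap.exists_norm_le_of_isClosed_range
    (E := StrongDual ℂ A) (F := A →L[ℂ] StrongDual ℂ A) (innerDualDerivation A) hcl
  refine ⟨C, hC, fun φ M hM hφ a b => ?_⟩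
  obtain ⟨ψ, hψ, hn⟩ := hpre φ
  have hle : ‖innerDualDerivation A φ‖ ≤ M := by
    refine ContinuousLinearMap.opNorm_le_bound₂ _ hM fun a b => ?_
    rw [innerDualDerivation_apply]
    exact (hφ b a).trans_eq (by ring)
  -- Equality of the two inner derivations means precisely that `φ` and `ψ` agree on commutators.
  have heq : ψ (a * b) - ψ (b * a) = φ (a * b) - φ (b * a) := by
    rw [← innerDualDerivation_apply, ← innerDualDerivation_apply, hψ]
  rw [← heq, ← map_sub]
  refine (ψ.le_opNorm _).trans ?_
  gcongr
  exact hn.trans (by gcongr)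

end WeakAmenability

/-! ## Functionals on Beurling algebras -/

namespace BeurlingAlgebra

/-! ### Functionals given by measurable functions dominated by the weight -/

section Functional

variable {G : Type*} [Group G] [TopologicalSpace G] [MeasurableSpace G] [OpensMeasurableSpace G]
  {ω : GroupWeight G} {μ : Measure G}

theorem integrable_norm_rep_mul (f : BeurlingAlgebra ω μ) :
    Integrable (fun x => ‖f.rep x‖ * ω x) μ := by
  refine ((mem_iff f.rep).1 f.integrable_rep).norm.congr (ae_of_all _ fun x => ?_)
  simp [abs_of_pos (ω.pos x)]

theorem norm_rep_mul_le {φ : G → ℂ} {K : ℝ} (hφK : ∀ x, ‖φ x‖ ≤ K * ω x)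
    (f : BeurlingAlgebra ω μ) (x : G) : ‖f.rep x * φ x‖ ≤ K * (‖f.rep x‖ * ω x) := by
  rw [norm_mul]
  exact (mul_le_mul_of_nonneg_left (hφK x) (norm_nonneg _)).trans_eq (by ring)

theorem integrable_rep_mul {φ : G → ℂ} (hφ : Measurable φ) {K : ℝ} (hφK : ∀ x, ‖φ x‖ ≤ K * ω x)
    (f : BeurlingAlgebra ω μ) : Integrable (fun x => f.rep x * φ x) μ :=
  (f.integrable_norm_rep_mul.const_mul K).mono'
    (f.aestronglyMeasurable_rep.mul hφ.aestronglyMeasurable)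
    (ae_of_all _ fun x => norm_rep_mul_le hφK f x)

/-- The functional `f ↦ ∫ f φ` on `L¹(G, ω)` defined by a measurable function `φ = O(ω)`. -/
noncomputable def functional (φ : G → ℂ) (hφ : Measurable φ) (K : ℝ)
    (hφK : ∀ x, ‖φ x‖ ≤ K * ω x) : StrongDual ℂ (BeurlingAlgebra ω μ) :=
  LinearMap.mkContinuous
    { toFun f := ∫ x, f.rep x * φ x ∂μ
      map_add' f g := by
        rw [← integral_add (integrable_rep_mul hφ hφK f) (integrable_rep_mul hφ hφK g)]
        refine integral_congr_ae ?_
        filter_upwards [rep_add f g] with x hx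
        rw [hx, add_mul]
      map_smul' c f := by
        rw [RingHom.id_apply, smul_eq_mul, ← integral_const_mul]
        refine integral_congr_ae ?_
        filter_upwards [rep_smul c f] with x hx
        rw [hx, mul_assoc] } K fun f => by
    change ‖∫ x, f.rep x * φ x ∂μ‖ ≤ _
    rw [norm_eq, ← integral_const_mul]
    exact norm_integral_le_of_norm_le (f.integrable_norm_rep_mul.const_mul K)
      (ae_of_all _ fun x => norm_rep_mul_le hφK f x)

theorem functional_apply (φ : G → ℂ) (hφ : Measurable φ) (K : ℝ)
    (hφK : ∀ x, ‖φ x‖ ≤ K * ω x) (f : BeurlingAlgebra ω μ) :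
    functional φ hφ K hφK f = ∫ x, f.rep x * φ x ∂μ := rfl

end Functional

/-! ### Commutators as double integrals, and indicators of compact sets -/

section Product

variable {G : Type*} [Group G] [TopologicalSpace G] [IsTopologicalGroup G]
  [LocallyCompactSpace G] [SecondCountableTopology G] [MeasurableSpace G] [BorelSpace G]
  {ω : GroupWeight G} {μ : Measure G} [μ.IsHaarMeasure]

theorem integrable_prod_rep_mul {φ : G × G → ℂ} (hφ : Measurable φ) {K : ℝ}
    (hφK : ∀ p, ‖φ p‖ ≤ K * (ω p.1 * ω p.2)) (f g : BeurlingAlgebra ω μ) :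
    Integrable (fun p : G × G => f.rep p.1 * g.rep p.2 * φ p) (μ.prod μ) := by
  refine ((f.integrable_norm_rep_mul.mul_prod g.integrable_norm_rep_mul).const_mul K).mono'
    ((f.aestronglyMeasurable_rep.comp_fst.mul g.aestronglyMeasurable_rep.comp_snd).mul
      hφ.aestronglyMeasurable) (ae_of_all _ fun p => ?_)
  rw [norm_mul, norm_mul]
  exact (mul_le_mul_of_nonneg_left (hφK p) (by positivity)).trans_eq (by ring)

theorem norm_comp_mul_le {φ : G → ℂ} {K : ℝ} (hφK : ∀ x, ‖φ x‖ ≤ K * ω x) (x y : G) :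
    ‖φ (x * y)‖ ≤ K * (ω x * ω y) := by
  -- Submultiplicativity will be multiplied by `K`; its sign is forced by the bound at the identity.
  have hK : 0 ≤ K := by
    by_contra! h
    exact absurd ((norm_nonneg _).trans (hφK 1)) (not_le.2 (mul_neg_of_neg_of_pos h (ω.pos 1)))
  exact (hφK _).trans (mul_le_mul_of_nonneg_left (ω.submul x y) hK)

theorem functional_mul {φ : G → ℂ} (hφ : Measurable φ) {K : ℝ} (hφK : ∀ x, ‖φ x‖ ≤ K * ω x)
    (f g : BeurlingAlgebra ω μ) :
    functional φ hφ K hφK (f * g) =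
      ∫ p : G × G, f.rep p.1 * g.rep p.2 * φ (p.1 * p.2) ∂(μ.prod μ) := by
  -- The shear `(y, x) ↦ (y, y⁻¹ * x)` turns the tensor kernel into the convolution kernel; Fubini
  -- then recovers the convolution.
  have hmp : MeasurePreserving (MeasurableEquiv.shearMulRight G).symm (μ.prod μ) (μ.prod μ) :=
    measurePreserving_prod_inv_mul μ μ
  have hF := integrable_prod_rep_mul (hφ.comp measurable_mul)
    (fun p => norm_comp_mul_le hφK p.1 p.2) f g
  have hF' : Integrable (fun p : G × G => f.rep p.1 * g.rep (p.1⁻¹ * p.2) * φ p.2)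
      (μ.prod μ) := by
    refine (hmp.integrable_comp_of_integrable hF).congr (ae_of_all _ fun p => ?_)
    simp [MeasurableEquiv.shearMulRight]
  have h1 : ∫ p : G × G, f.rep p.1 * g.rep (p.1⁻¹ * p.2) * φ p.2 ∂(μ.prod μ) =
      ∫ p : G × G, f.rep p.1 * g.rep p.2 * φ (p.1 * p.2) ∂(μ.prod μ) := by
    rw [← hmp.integral_comp' fun p : G × G => f.rep p.1 * g.rep p.2 * φ (p.1 * p.2)]
    refine integral_congr_ae (ae_of_all _ fun p => ?_)
    simp [MeasurableEquiv.shearMulRight]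
  rw [← h1, integral_prod_symm _ hF', functional_apply]
  refine integral_congr_ae ?_
  filter_upwards [rep_mul f g] with x hx
  rw [hx, groupConvolution, ← integral_mul_const]

theorem functional_commutator {φ : G → ℂ} (hφ : Measurable φ) {K : ℝ}
    (hφK : ∀ x, ‖φ x‖ ≤ K * ω x) (f g : BeurlingAlgebra ω μ) :
    functional φ hφ K hφK (f * g) - functional φ hφ K hφK (g * f) =
      ∫ p : G × G, f.rep p.1 * g.rep p.2 * (φ (p.1 * p.2) - φ (p.2 * p.1)) ∂(μ.prod μ) := by
  rw [functional_mul, functional_mul,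
    ← integral_prod_swap fun p : G × G => g.rep p.1 * f.rep p.2 * φ (p.1 * p.2), ← integral_sub]
  · refine integral_congr_ae (ae_of_all _ fun p => ?_)
    simp only [Prod.fst_swap, Prod.snd_swap]
    ring
  · exact integrable_prod_rep_mul (hφ.comp measurable_mul)
      (fun p => norm_comp_mul_le hφK p.1 p.2) f g
  · exact (integrable_prod_rep_mul (hφ.comp measurable_mul)
      (fun p => norm_comp_mul_le hφK p.1 p.2) g f).swap

theorem norm_functional_commutator_le {φ : G → ℂ} (hφ : Measurable φ) {K : ℝ}
    (hφK : ∀ x, ‖φ x‖ ≤ K * ω x) {M : ℝ}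
    (hM : ∀ x y, ‖φ (x * y) - φ (y * x)‖ ≤ M * (ω x * ω y)) (f g : BeurlingAlgebra ω μ) :
    ‖functional φ hφ K hφK (f * g) - functional φ hφ K hφK (g * f)‖ ≤ M * ‖f‖ * ‖g‖ := by
  rw [functional_commutator, norm_eq, norm_eq, mul_assoc, ← integral_prod_mul,
    ← integral_const_mul]
  refine norm_integral_le_of_norm_le
    ((f.integrable_norm_rep_mul.mul_prod g.integrable_norm_rep_mul).const_mul M)
    (ae_of_all _ fun p => ?_)
  rw [norm_mul, norm_mul]
  exact (mul_le_mul_of_nonneg_left (hM p.1 p.2) (by positivity)).trans_eq (by ring)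

/-- The indicator function of a compact set as an element of `L¹(G, ω)`. -/
noncomputable def indicator [T2Space G] (E : Set G) (hE : IsCompact E) : BeurlingAlgebra ω μ :=
  mk (E.indicator fun _ => 1) <| by
    rw [mem_iff]
    have h : (fun x => E.indicator (fun _ => (1 : ℂ)) x * (ω x : ℂ)) =
        E.indicator fun x => (ω x : ℂ) := by
      ext x
      by_cases hx : x ∈ E <;> simp [hx]
    rw [h, integrable_indicator_iff hE.measurableSet]
    exact (Complex.continuous_ofReal.comp ω.continuous_toFun).continuousOn.integrableOn_compact hE

variable [T2Space G]

theorem rep_indicator {E : Set G} (hE : IsCompact E) :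
    (indicator E hE : BeurlingAlgebra ω μ).rep =ᵐ[μ] E.indicator fun _ => 1 :=
  rep_mk _ _

theorem integral_indicator_rep_mul {E F : Set G} (hE : IsCompact E) (hF : IsCompact F)
    (φ : G × G → ℂ) :
    ∫ p : G × G, (indicator E hE : BeurlingAlgebra ω μ).rep p.1 *
      (indicator F hF : BeurlingAlgebra ω μ).rep p.2 * φ p ∂(μ.prod μ) =
    ∫ p in E ×ˢ F, φ p ∂(μ.prod μ) := by
  rw [← integral_indicator (hE.measurableSet.prod hF.measurableSet)]
  refine integral_congr_ae ?_
  have h1 := Measure.quasiMeasurePreserving_fst (μ := μ) (ν := μ)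
    |>.ae_eq_comp (rep_indicator (ω := ω) hE)
  have h2 := Measure.quasiMeasurePreserving_snd (μ := μ) (ν := μ)
    |>.ae_eq_comp (rep_indicator (ω := ω) hF)
  filter_upwards [h1, h2] with p hp1 hp2
  simp only [Function.comp] at hp1 hp2
  rw [hp1, hp2]
  by_cases h1 : p.1 ∈ E <;> by_cases h2 : p.2 ∈ F <;> simp [h1, h2]

/-- The product of two indicators is nonnegative, so its norm is the value of the functional given
by `ω` itself, and `functional_mul` makes it an integral of `ω (x * y)` over `E ×ˢ F`. -/
theorem norm_indicator_mul_le {E F : Set G} (hE : IsCompact E) (hF : IsCompact F) {M : ℝ}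
    (hM : ∀ x ∈ E, ∀ y ∈ F, ω (x * y) ≤ M) :
    ‖(indicator E hE * indicator F hF : BeurlingAlgebra ω μ)‖ ≤
      M * (μ.prod μ).real (E ×ˢ F) := by
  set a : BeurlingAlgebra ω μ := indicator E hE
  set b : BeurlingAlgebra ω μ := indicator F hF
  have hφ : Measurable fun x => (ω x : ℂ) := by
    have := ω.continuous_toFun.measurable
    fun_prop
  have hφK (x : G) : ‖(ω x : ℂ)‖ ≤ 1 * ω x := by simp [abs_of_pos (ω.pos x)]
  have h1 : functional _ hφ 1 hφK (a * b) = ((‖a * b‖ : ℝ) : ℂ) := by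
    rw [functional_apply, norm_eq, ← integral_complex_ofReal]
    refine integral_congr_ae ?_
    filter_upwards [rep_mul a b] with x hx
    rw [groupConvolution_congr (rep_indicator hE) (rep_indicator hF)] at hx
    have h2 : (a * b).rep x =
        ((∫ y, E.indicator (fun _ => (1 : ℝ)) y * F.indicator (fun _ => (1 : ℝ)) (y⁻¹ * x) ∂μ
          : ℝ) : ℂ) := by
      rw [hx, groupConvolution, ← integral_complex_ofReal]
      congr 1
      ext y
      by_cases h1 : y ∈ E <;> by_cases h2 : y⁻¹ * x ∈ F <;> simp [h1, h2]
    have h3 : 0 ≤ ∫ y, E.indicator (fun _ => (1 : ℝ)) y *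
        F.indicator (fun _ => (1 : ℝ)) (y⁻¹ * x) ∂μ :=
      integral_nonneg fun y => mul_nonneg (Set.indicator_nonneg (fun _ _ => zero_le_one) _)
        (Set.indicator_nonneg (fun _ _ => zero_le_one) _)
    rw [h2, Complex.norm_real, Real.norm_of_nonneg h3, Complex.ofReal_mul]
  rw [functional_mul, integral_indicator_rep_mul hE hF fun p => (ω (p.1 * p.2) : ℂ)] at h1
  have h2 : ‖(a * b)‖ = ‖((‖a * b‖ : ℝ) : ℂ)‖ := by simp
  rw [h2, ← h1]
  refine norm_setIntegral_le_of_norm_le_const (hE.prod hF).measure_lt_top fun p hp => ?_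
  rw [Complex.norm_real, Real.norm_of_nonneg (ω.pos _).le]
  exact hM _ hp.1 _ hp.2

theorem le_norm_functional_indicator_commutator {φ : G → ℝ}
    (hφ : Measurable fun x => (φ x : ℂ)) {K : ℝ}
    (hφK : ∀ x, ‖(φ x : ℂ)‖ ≤ K * ω x) {E F : Set G} (hE : IsCompact E) (hF : IsCompact F)
    {c : ℝ} (hc : ∀ x ∈ E, ∀ y ∈ F, c ≤ φ (x * y) - φ (y * x)) :
    c * (μ.prod μ).real (E ×ˢ F) ≤
      ‖functional (μ := μ) _ hφ K hφK (indicator E hE * indicator F hF) -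
        functional (μ := μ) _ hφ K hφK (indicator F hF * indicator E hE)‖ := by
  have hmE := hE.measurableSet.prod hF.measurableSet
  rw [functional_commutator, integral_indicator_rep_mul hE hF
    fun p => (φ (p.1 * p.2) : ℂ) - (φ (p.2 * p.1) : ℂ)]
  simp only [← Complex.ofReal_sub]
  rw [integral_complex_ofReal, Complex.norm_real]
  refine le_trans ?_ (Real.le_norm_self _)
  refine setIntegral_ge_of_const_le_real hmE (hE.prod hF).measure_lt_top.ne
    (fun p hp => hc _ hp.1 _ hp.2) ?_
  have := ω.continuous_toFun
  have hb : ContinuousOn (fun p : G × G => K * (ω p.1 * ω p.2) + K * (ω p.2 * ω p.1))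
      (E ×ˢ F) := by fun_prop
  refine (hb.integrableOn_compact (hE.prod hF)).mono' ?_ (ae_of_all _ fun p => ?_)
  · have hφ' : Measurable φ := Complex.measurable_re.comp hφ
    have : Measurable fun p : G × G => φ (p.1 * p.2) - φ (p.2 * p.1) := by fun_prop
    exact this.aestronglyMeasurable
  · rw [← Complex.norm_real, Complex.ofReal_sub]
    exact (norm_sub_le _ _).trans
      (add_le_add (norm_comp_mul_le hφK p.1 p.2) (norm_comp_mul_le hφK p.2 p.1))

end Product

end BeurlingAlgebra

/-! ## Beurling algebras on the Heisenberg group -/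

namespace HeisenbergGroup

/-- The truncation of `|w| / R` at height `N`, cut off to `|u|, |v| ≤ 1`. -/
noncomputable def truncatedHeight (N R : ℝ) (x : HeisenbergGroup) : ℝ :=
  if |x.u| ≤ 1 ∧ |x.v| ≤ 1 then min N (|x.w| / R) else 0

theorem measurable_truncatedHeight (N R : ℝ) : Measurable (truncatedHeight N R) := by
  have hu := continuous_u
  have hv := continuous_v
  have hw := continuous_w.measurable
  refine Measurable.ite ?_ (by fun_prop) measurable_const
  exact ((isClosed_le hu.abs continuous_const).inter
    (isClosed_le hv.abs continuous_const)).measurableSet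

theorem abs_truncatedHeight_le {N R : ℝ} (hN : 0 ≤ N) (hR : 0 ≤ R) (x : HeisenbergGroup) :
    |truncatedHeight N R x| ≤ N := by
  unfold truncatedHeight
  split_ifs
  · rw [abs_of_nonneg (le_min hN (by positivity))]
    exact min_le_left _ _
  · simpa using hN

theorem abs_mul_w_sub_le {x y : HeisenbergGroup} (hu : |x.u + y.u| ≤ 1) (hv : |x.v + y.v| ≤ 1) :
    |(x * y).w - (y * x).w| ≤ |x.u| + |x.v| := by
  -- Adding and subtracting `x.u * x.v` leaves `y` only in the sums bounded by 1.
  have h : (x * y).w - (y * x).w = x.u * (x.v + y.v) - (x.u + y.u) * x.v := by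
    simp only [mul_w]
    ring
  rw [h]
  refine (abs_sub _ _).trans ?_
  rw [abs_mul, abs_mul]
  exact add_le_add (mul_le_of_le_one_right (abs_nonneg _) hv)
    (mul_le_of_le_one_left (abs_nonneg _) hu)

theorem abs_truncatedHeight_sub_le {N R : ℝ} (hN : 0 ≤ N) (hR : 0 < R) (x y : HeisenbergGroup) :
    |truncatedHeight N R (x * y) - truncatedHeight N R (y * x)| ≤
      min N ((|x.u| + |x.v|) / R) := by
  unfold truncatedHeight
  -- The coordinates `u`, `v` of `x * y` and `y * x` coincide, so the cutoff keeps both products or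
  -- neither.
  simp only [mul_u, mul_v, add_comm y.u, add_comm y.v]
  split_ifs with h
  · refine le_min ?_ ?_
    · have h1 : 0 ≤ min N (|(x * y).w| / R) := le_min hN (by positivity)
      have h2 : 0 ≤ min N (|(y * x).w| / R) := le_min hN (by positivity)
      rw [abs_sub_le_iff]
      constructor <;> linarith [min_le_left N (|(x * y).w| / R), min_le_left N (|(y * x).w| / R)]
    · calc |min N (|(x * y).w| / R) - min N (|(y * x).w| / R)|
          ≤ |(|(x * y).w| / R - |(y * x).w| / R)| := by
            simpa using abs_min_sub_min_le_max N (|(x * y).w| / R) N (|(y * x).w| / R)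
        _ = |(|(x * y).w| - |(y * x).w|)| / R := by rw [← sub_div, abs_div, abs_of_pos hR]
        _ ≤ (|x.u| + |x.v|) / R := by
            gcongr
            exact (abs_abs_sub_abs_le _ _).trans (abs_mul_w_sub_le h.1 h.2)
  · simpa using ⟨hN, by positivity⟩

/-- A compact box on which `u` is bounded away from `0`. -/
def box : Set HeisenbergGroup :=
  coordsHomeomorph ⁻¹' (Set.Icc (1 / 8) (1 / 2) ×ˢ Set.Icc (-(1 / 2)) (1 / 2) ×ˢ Set.Icc (-1) 1)

theorem isCompact_box : IsCompact box :=
  coordsHomeomorph.isCompact_preimage.2 (isCompact_Icc.prod (isCompact_Icc.prod isCompact_Icc))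

theorem mem_box {x : HeisenbergGroup} :
    x ∈ box ↔ (1 / 8 ≤ x.u ∧ x.u ≤ 1 / 2) ∧ (-(1 / 2) ≤ x.v ∧ x.v ≤ 1 / 2) ∧
      -1 ≤ x.w ∧ x.w ≤ 1 := Iff.rfl

/-- Used for a left and a right translation, so that the volumes can be cancelled at the end. -/
theorem volume_preimage_box_pos (e : HeisenbergGroup ≃ₜ HeisenbergGroup) :
    0 < (volume : Measure HeisenbergGroup).real (e ⁻¹' box) := by
  refine ENNReal.toReal_pos (ne_of_gt ?_) (e.isCompact_preimage.2 isCompact_box).measure_ne_top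
  have ho : IsOpen (e ⁻¹' (coordsHomeomorph ⁻¹'
      (Set.Ioo (1 / 8) (1 / 2) ×ˢ Set.Ioo (-(1 / 2)) (1 / 2) ×ˢ Set.Ioo (-1) 1))) :=
    (((isOpen_Ioo.prod (isOpen_Ioo.prod isOpen_Ioo)).preimage coordsHomeomorph.continuous).preimage
      e.continuous)
  refine (ho.measure_pos _ ⟨e.symm ⟨1 / 4, 0, 0⟩, ?_⟩).trans_le (measure_mono ?_)
  · rw [Set.mem_preimage, e.apply_symm_apply]
    change ((1 / 8 : ℝ) < 1 / 4 ∧ (1 / 4 : ℝ) < 1 / 2) ∧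
      ((-(1 / 2) : ℝ) < 0 ∧ (0 : ℝ) < 1 / 2) ∧ (-1 : ℝ) < 0 ∧ (0 : ℝ) < 1
    norm_num
  · refine Set.preimage_mono (Set.preimage_mono ?_)
    exact Set.prod_mono Set.Ioo_subset_Icc_self
      (Set.prod_mono Set.Ioo_subset_Icc_self Set.Ioo_subset_Icc_self)

/-- With `s = (0, S, 0)`, `x = s * b` and `y = b' * s⁻¹`, one has `y * x = b' * b` and `x * y = s *
(b * b') * s⁻¹`. The conjugation shifts `w` by `-S * (b.u + b'.u)`, and `b.u + b'.u ≥ 1/4`; before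
the shift, `|w| ≤ 1 + 1 + 1/4`. -/
theorem conjugate_box_bounds {S : ℝ} (hS : 0 ≤ S) {x y : HeisenbergGroup}
    (hx : (⟨0, S, 0⟩ : HeisenbergGroup)⁻¹ * x ∈ box) (hy : y * ⟨0, S, 0⟩ ∈ box) :
    |x.u + y.u| ≤ 1 ∧ |x.v + y.v| ≤ 1 ∧ S / 4 - 3 ≤ |(x * y).w| ∧ |(y * x).w| ≤ 3 := by
  rw [mem_box] at hx hy
  simp only [mul_u, mul_v, mul_w, inv_u, inv_v, inv_w] at hx hy
  obtain ⟨⟨h1, h2⟩, ⟨h3, h4⟩, h5, h6⟩ := hx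
  obtain ⟨⟨k1, k2⟩, ⟨k3, k4⟩, k5, k6⟩ := hy
  simp only [mul_w]
  refine ⟨abs_le.2 ⟨by linarith, by linarith⟩, abs_le.2 ⟨by linarith, by linarith⟩, ?_, ?_⟩
  · rw [le_abs]
    right
    nlinarith
  · rw [abs_le]
    constructor <;> nlinarith

theorem le_truncatedHeight_sub {N R S : ℝ} (hN : 0 ≤ N) (hR : 1 ≤ R) (hS : 4 * (N * R + 3) ≤ S)
    {x y : HeisenbergGroup}
    (hx : (⟨0, S, 0⟩ : HeisenbergGroup)⁻¹ * x ∈ box) (hy : y * ⟨0, S, 0⟩ ∈ box) :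
    N - 3 ≤ truncatedHeight N R (x * y) - truncatedHeight N R (y * x) := by
  have hNR : 0 ≤ N * R := by positivity
  obtain ⟨h1, h2, h3, h4⟩ := conjugate_box_bounds (by linarith) hx hy
  unfold truncatedHeight
  simp only [mul_u, mul_v, add_comm y.u, add_comm y.v, h1, h2, and_self, if_true]
  -- The size of `S` gives `S / 4 - 3 ≥ N * R`, so the truncation is saturated at `x * y`.
  have h5 : N ≤ |(x * y).w| / R := by
    rw [le_div_iff₀ (by linarith)]
    linarith
  have h6 : |(y * x).w| / R ≤ 3 := by
    rw [div_le_iff₀ (by linarith)]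
    linarith
  rw [min_eq_left h5]
  linarith [min_le_right N (|(y * x).w| / R)]

end HeisenbergGroup

/-! ### Weights tending to infinity, and the contradiction -/

namespace GroupWeight

open HeisenbergGroup

variable {ω : GroupWeight HeisenbergGroup} {W : ℝ≥0 × ℝ≥0 → ℝ}

theorem one_le_of_symmetric {G : Type*} [Group G] [TopologicalSpace G] {ω : GroupWeight G}
    (hω : ∀ x, ω x⁻¹ = ω x) (x : G) : 1 ≤ ω x := by
  have h1 : ω 1 ≤ ω 1 * ω 1 := by simpa using ω.submul 1 1
  have h2 : ω 1 ≤ ω x * ω x := by simpa [hω] using ω.submul x x⁻¹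
  have h3 : 1 ≤ ω 1 := le_of_mul_le_mul_left (by simpa using h1) (ω.pos 1)
  nlinarith [ω.pos x]

/-- The set is unbounded in `w`, but `ω` does not see `w`, so compactness of the square in the plane
`w = 0` suffices. -/
theorem exists_le_of_mem_unit_square (hW : ∀ x, ω x = W (‖x.u‖₊, ‖x.v‖₊)) :
    ∃ M, ∀ x : HeisenbergGroup, |x.u| ≤ 1 → |x.v| ≤ 1 → ω x ≤ M := by
  have hc : Continuous fun p : ℝ × ℝ => ω (coordsHomeomorph.symm (p.1, p.2, 0)) := by
    have := ω.continuous_toFun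
    fun_prop
  obtain ⟨M, hM⟩ := (isCompact_Icc (a := ((-1, -1) : ℝ × ℝ)) (b := (1, 1))).bddAbove_image
    hc.continuousOn
  refine ⟨M, fun x hu hv => ?_⟩
  have h : ω x = ω (coordsHomeomorph.symm (x.u, x.v, 0)) := by
    rw [hW, hW]
    rfl
  rw [h]
  exact hM ⟨(x.u, x.v), ⟨⟨(abs_le.1 hu).1, (abs_le.1 hv).1⟩, ⟨(abs_le.1 hu).2, (abs_le.1 hv).2⟩⟩,
    rfl⟩

theorem exists_forall_le (hW : ∀ x, ω x = W (‖x.u‖₊, ‖x.v‖₊))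
    (hlim : Tendsto W (cocompact (ℝ≥0 × ℝ≥0)) atTop) (N : ℝ) :
    ∃ R, 1 ≤ R ∧ ∀ x : HeisenbergGroup, R ≤ |x.u| + |x.v| → N ≤ ω x := by
  obtain ⟨K, hK, hKN⟩ := mem_cocompact.1 (hlim.eventually_ge_atTop N)
  have hc : Continuous fun p : ℝ≥0 × ℝ≥0 => (p.1 + p.2 : ℝ) := by fun_prop
  obtain ⟨R, hR⟩ := hK.bddAbove_image hc.continuousOn
  -- The `+ 1` puts the point strictly outside the compact set; the lower bound 1 is needed in
  -- `le_truncatedHeight_sub`.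
  refine ⟨max 1 (R + 1), le_max_left _ _, fun x hx => ?_⟩
  rw [hW]
  refine hKN fun hmem => ?_
  have h : |x.u| + |x.v| ≤ R := hR ⟨_, hmem, rfl⟩
  linarith [le_max_right 1 (R + 1)]

/-- Far out, `N ≤ ω x` absorbs the truncation height; elsewhere the slope `1 / R` keeps the
difference below 1. The resulting constant does not depend on `N`. -/
theorem abs_truncatedHeight_sub_le_mul (hω : ∀ x, 1 ≤ ω x) {N R : ℝ} (hN : 0 ≤ N) (hR : 0 < R)
    (h : ∀ x : HeisenbergGroup, R ≤ |x.u| + |x.v| → N ≤ ω x) (x y : HeisenbergGroup) :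
    |truncatedHeight N R (x * y) - truncatedHeight N R (y * x)| ≤ ω x * ω y := by
  refine (abs_truncatedHeight_sub_le hN hR x y).trans (le_trans ?_
    (le_mul_of_one_le_right (ω.pos x).le (hω y)))
  by_cases hx : R ≤ |x.u| + |x.v|
  · exact (min_le_left _ _).trans (h x hx)
  · refine (min_le_right _ _).trans (le_trans ?_ (hω x))
    rw [div_le_one hR]
    exact (not_le.1 hx).le

theorem not_isWeaklyAmenable (hW : ∀ x, ω x = W (‖x.u‖₊, ‖x.v‖₊))
    (hlim : Tendsto W (cocompact (ℝ≥0 × ℝ≥0)) atTop) :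
    ¬ IsWeaklyAmenable (BeurlingAlgebra ω volume) := by
  intro hwa
  obtain ⟨C, hC, hcomm⟩ := hwa.exists_norm_commutator_le
  have hω : ∀ x, 1 ≤ ω x := one_le_of_symmetric fun x => by simp [hW]
  obtain ⟨M, hM⟩ := exists_le_of_mem_unit_square hW
  have hM0 : 0 < M := (ω.pos 1).trans_le (hM 1 (by simp) (by simp))
  -- One more than the final inequality `N - 3 ≤ 2 * C * M` allows. `C` and `M` are fixed before
  -- `N`, then `R` and `S` depend on it.
  set N : ℝ := 2 * C * M + 4
  have hN : 0 ≤ N := by positivity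
  obtain ⟨R, hR, hNR⟩ := exists_forall_le hW hlim N
  set S : ℝ := 4 * (N * R + 3)
  have hS : 0 ≤ S := by positivity
  set s : HeisenbergGroup := ⟨0, S, 0⟩
  have hE : IsCompact (Homeomorph.mulLeft s⁻¹ ⁻¹' box) :=
    (Homeomorph.mulLeft s⁻¹).isCompact_preimage.2 isCompact_box
  have hF : IsCompact (Homeomorph.mulRight s ⁻¹' box) :=
    (Homeomorph.mulRight s).isCompact_preimage.2 isCompact_box
  have : T2Space HeisenbergGroup := coordsHomeomorph.symm.t2Space
  have hφ : Measurable fun x => (truncatedHeight N R x : ℂ) :=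
    Complex.measurable_ofReal.comp (measurable_truncatedHeight N R)
  have hφK (x : HeisenbergGroup) : ‖(truncatedHeight N R x : ℂ)‖ ≤ N * ω x := by
    rw [Complex.norm_real]
    exact (abs_truncatedHeight_le hN (by linarith) x).trans (le_mul_of_one_le_right hN (hω x))
  have hlow := BeurlingAlgebra.le_norm_functional_indicator_commutator (μ := volume) hφ hφK hE hF
    (c := N - 3) fun x hx y hy => le_truncatedHeight_sub hN hR le_rfl hx hy
  -- The functional is only known to have norm at most `N`, but its commutator bound is 1, and only
  -- the latter enters.
  have hup := hcomm (BeurlingAlgebra.functional _ hφ N hφK) 1 zero_le_one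
    (BeurlingAlgebra.norm_functional_commutator_le hφ hφK fun x y => by
      rw [← Complex.ofReal_sub, Complex.norm_real, one_mul]
      exact abs_truncatedHeight_sub_le_mul hω hN (by linarith) hNR x y)
    (BeurlingAlgebra.indicator _ hE) (BeurlingAlgebra.indicator _ hF)
  have hab := BeurlingAlgebra.norm_indicator_mul_le (ω := ω) (μ := volume) hE hF (M := M)
    fun x hx y hy => by
      obtain ⟨h1, h2, -⟩ := conjugate_box_bounds hS hx hy
      exact hM _ h1 h2
  have hba := BeurlingAlgebra.norm_indicator_mul_le (ω := ω) (μ := volume) hF hE (M := M)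
    fun y hy x hx => by
      obtain ⟨h1, h2, -⟩ := conjugate_box_bounds hS hx hy
      exact hM _ (by rwa [mul_u, add_comm]) (by rwa [mul_v, add_comm])
  have hEpos := volume_preimage_box_pos (Homeomorph.mulLeft s⁻¹)
  have hFpos := volume_preimage_box_pos (Homeomorph.mulRight s)
  rw [measureReal_prod_prod] at hlow hab hba
  rw [mul_comm (Measure.real _ _)] at hba
  set V := (volume : Measure HeisenbergGroup).real (Homeomorph.mulLeft s⁻¹ ⁻¹' box) *
    (volume : Measure HeisenbergGroup).real (Homeomorph.mulRight s ⁻¹' box)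
  have hV : 0 < V := mul_pos hEpos hFpos
  have h1 : (N - 3) * V ≤ C * 1 * (M * V + M * V) :=
    hlow.trans (hup.trans (mul_le_mul_of_nonneg_left
      ((norm_sub_le _ _).trans (add_le_add hab hba)) (by positivity)))
  have h2 : N - 3 ≤ 2 * C * M := le_of_mul_le_mul_right (h1.trans_eq (by ring)) hV
  linarith

/-- The polynomial weight `(1 + |u| + |v|) ^ α`. -/
noncomputable def polynomial (α : ℝ) (hα : 0 ≤ α) : GroupWeight HeisenbergGroup where
  toFun x := (1 + |x.u| + |x.v|) ^ α
  continuous_toFun := by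
    have := continuous_u
    have := continuous_v
    exact Continuous.rpow_const (by fun_prop) fun _ => Or.inr hα
  pos x := by positivity
  submul x y := by
    rw [← Real.mul_rpow (by positivity) (by positivity)]
    refine Real.rpow_le_rpow (by positivity) ?_ hα
    rw [mul_u, mul_v]
    nlinarith [abs_add_le x.u y.u, abs_add_le x.v y.v, abs_nonneg x.u, abs_nonneg y.u,
      abs_nonneg x.v, abs_nonneg y.v, mul_nonneg (abs_nonneg x.u) (abs_nonneg y.u),
      mul_nonneg (abs_nonneg x.u) (abs_nonneg y.v), mul_nonneg (abs_nonneg x.v) (abs_nonneg y.u),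
      mul_nonneg (abs_nonneg x.v) (abs_nonneg y.v)]

/-- The base dominates the sup distance to the origin, which tends to infinity in a proper space. -/
theorem tendsto_polynomial {α : ℝ} (hα : 0 < α) :
    Tendsto (fun p : ℝ≥0 × ℝ≥0 => (1 + (p.1 : ℝ) + p.2) ^ α) (cocompact (ℝ≥0 × ℝ≥0)) atTop := by
  refine (tendsto_rpow_atTop hα).comp ?_
  refine tendsto_atTop_mono (fun p => ?_) (tendsto_dist_right_cocompact_atTop (0 : ℝ≥0 × ℝ≥0))
  rw [Prod.dist_eq, NNReal.dist_eq, NNReal.dist_eq]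
  have h1 := p.1.coe_nonneg
  have h2 := p.2.coe_nonneg
  simp only [Prod.fst_zero, Prod.snd_zero, NNReal.coe_zero, sub_zero, abs_of_nonneg h1,
    abs_of_nonneg h2]
  exact max_le (by linarith) (by linarith)

end GroupWeight

theorem mainTheorem5 :
    (∀ (ω : GroupWeight HeisenbergGroup) (W : ℝ≥0 × ℝ≥0 → ℝ),
        (∀ x : HeisenbergGroup, ω x = W (‖x.u‖₊, ‖x.v‖₊)) →
        Tendsto W (cocompact (ℝ≥0 × ℝ≥0)) atTop →
        ¬ IsWeaklyAmenable (BeurlingAlgebra ω volume)) ∧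
    (∀ α : ℝ, 0 < α →
        ∃ ω : GroupWeight HeisenbergGroup,
          (∀ x : HeisenbergGroup, ω x = (1 + |x.u| + |x.v|) ^ α) ∧
          ¬ IsWeaklyAmenable (BeurlingAlgebra ω volume)) :=
  ⟨fun _ _ hW hlim => GroupWeight.not_isWeaklyAmenable hW hlim,
    fun α hα => ⟨GroupWeight.polynomial α hα.le, fun _ => rfl,
      GroupWeight.not_isWeaklyAmenable (fun _ => rfl) (GroupWeight.tendsto_polynomial hα)⟩⟩
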